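/- \textbf{Setting.} Let $f_1,\dots,f_K:\mathbb{R}^d\to\mathbb{R}$ be differentiable and write $\mathbb{E}[h_k]=\frac1K\sum_{j=1}^K h_j$ for a uniformly chosen index $k\in\{1,\dots,K\}$. For $g:\mathbb{R}^d\to\mathbb{R}$ and a symmetric invertible matrix $\Sigma\in\mathbb{R}^{d\times d}$ let $$g_\Sigma(x)=\frac{1}{\pi^{d/2}}\int_{\mathbb{R}^d}g(x+\Sigma u)\,e^{-\|u\|^2}\,du ,$$ write $f_{j,\Sigma}=(f_j)_\Sigma$, and let $\|\Sigma\|$ be the operator norm for the Euclidean norm. \textbf{Algorithm (AGS-Adam).} Given $\eta_t>0$, $\epsilon>0$, $0\le\beta_t\le\beta<1$, $\theta_t\in(0,1)$ and symmetric positive definite matrices $\Sigma_t\in\mathbb{R}^{d\times d}$ for $t\ge1$, and $x_0\in\mathbb{R}^d$, put $m_0=v_0=0$. For $t=1,2,\dots$ draw $k_t$ uniformly from $\{1,\dots,K\}$, independently of the previous draws, and set $$m_t=\beta_tm_{t-1}+(1-\beta_t)\nabla f_{k_t,\Sigma_t}(x_{t-1}),\qquad v_t=\theta_tv_{t-1}+(1-\theta_t)\big(\nabla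 f_{k_t,\Sigma_t}(x_{t-1})\big)^2,\qquad x_t=x_{t-1}-\eta_t\frac{m_t}{\sqrt{v_t+\epsilon}},$$ where squares, square roots and quotients of vectors are taken coordinatewise. \textbf{Theorem (almost-sure convergence of AGS-Adam).} Let $f:\mathbb{R}^d\to\mathbb{R}$ be $L$-smooth (differentiable with $L$-Lipschitz gradient) and bounded below (for instance, let $f$ attain a minimum $f^*$). Assume that for all $x\in\mathbb{R}^d$ $$\mathbb{E}[f_k(x)]=f(x),\qquad \mathbb{E}[\nabla f_k(x)]=\nabla f(x),\qquad \mathbb{E}\big[\|\nabla f_k(x)\|^2\big]\le\lambda$$ for some constant $\lambda$. Suppose that $$\sum_{t=1}^\infty\eta_t=\infty,\qquad \sum_{t=1}^\infty\eta_t^2<\infty,\qquad \sum_{t=1}^\infty\eta_t(1-\theta_t)<\infty,$$ and that there are a non-increasing real sequence $(\alpha_t)_{t\ge1}$ and constants $C_0,\widetilde C_0>0$ with $C_0\alpha_t\le\eta_t\le\widetilde C_0\alpha_t$ for all $t\ge1$. Let $B$ and $\widetilde B$ be real-valued functions of pairs of matrices such that, for all symmetric positive definite $\Sigma,T\in\mathbb{R}^{d\times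 d}$ and all $x\in\mathbb{R}^d$, $$|f_\Sigma(x)-f_T(x)|\le B(\Sigma,T),\qquad \|\nabla f_\Sigma(x)-\nabla f_T(x)\|\le\widetilde B(\Sigma,T).$$ Suppose that for some $\widetilde M>0$, with $\Sigma_0$ an arbitrary matrix (e.g. $\Sigma_0=0$), $$\widetilde B(\Sigma_{t+1},\Sigma_t)\le\widetilde M\eta_t\ \ (t\ge1),\qquad \sum_{t=1}^\infty B(\Sigma_t,\Sigma_{t-1})<\infty,\qquad \|\Sigma_t\|\to0.$$ Then $$\lim_{t\to\infty}\|\nabla f(x_t)\|^2=0\ \text{ almost surely},\qquad \mathbb{E}\big[\|\nabla f(x_t)\|^2\big]<\infty\ \text{ for all } t,\qquad \lim_{t\to\infty}\mathbb{E}\big[\|\nabla f(x_t)\|^2\big]=0 .$$ -/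

import Mathlib

open MeasureTheory ProbabilityTheory Filter Topology

namespace AGSAdam

/-- The operator norm `max_{‖x‖ ≤ 1} ‖S x‖` of a matrix with respect to the Euclidean norm. -/
noncomputable def matOpNorm {d : ℕ} (S : Matrix (Fin d) (Fin d) ℝ) : ℝ :=
  ‖Matrix.toEuclideanCLM (n := Fin d) (𝕜 := ℝ) S‖

/-- The `S`-Gaussian smoothing of `g`,
`g_S(x) = π^{-d/2} ∫ g(x + S u) exp(-‖u‖²) du`. -/
noncomputable def gaussSmooth {d : ℕ} (S : Matrix (Fin d) (Fin d) ℝ)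
    (g : EuclideanSpace ℝ (Fin d) → ℝ) (x : EuclideanSpace ℝ (Fin d)) : ℝ :=
  1 / Real.pi ^ ((d : ℝ) / 2) *
    ∫ u : EuclideanSpace ℝ (Fin d),
      g (x + Matrix.toEuclideanCLM (n := Fin d) (𝕜 := ℝ) S u) * Real.exp (-‖u‖ ^ 2)

/-- `f` is `L`-smooth: it is differentiable and its gradient is `L`-Lipschitz. -/
def LSmooth {d : ℕ} (L : NNReal) (f : EuclideanSpace ℝ (Fin d) → ℝ) : Prop :=
  Differentiable ℝ f ∧ LipschitzWith L (gradient f)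

/-- The current iterate `x` and the two moment vectors `m`, `v` of the algorithm. -/
structure State (d : ℕ) where
  x : EuclideanSpace ℝ (Fin d)
  m : EuclideanSpace ℝ (Fin d)
  v : EuclideanSpace ℝ (Fin d)

/-- One Adam update with gradient sample `g`, learning rate `η`, momentum parameters `β`, `θ` and
regularization `ε`. The square, the square root and the quotient are taken coordinatewise. -/
noncomputable def State.step {d : ℕ} (η β θ ε : ℝ) (s : State d)
    (g : EuclideanSpace ℝ (Fin d)) : State d :=
  let m' : EuclideanSpace ℝ (Fin d) := β • s.m + (1 - β) • g
  let v' : EuclideanSpace ℝ (Fin d) := θ • s.v + (1 - θ) • WithLp.toLp 2 (fun i => g i ^ 2)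
  { x := s.x - η • WithLp.toLp 2 (fun i => m' i / √(v' i + ε))
    m := m'
    v := v' }

/-- The AGS-Adam algorithm for the functions `f 1, …, f K` (indexed by `Fin K`), run along the
sampled indices `k 1, k 2, …`: it starts from `(x₀, 0, 0)`, and step `t ≥ 1` uses the gradient of
the smoothed function `(f (k t))_{S t}` at the previous iterate. The values at `0` of `S`, `η`, `β`,
`θ`, `k` are never used. -/
noncomputable def run {d K : ℕ} (f : Fin K → EuclideanSpace ℝ (Fin d) → ℝ)
    (S : ℕ → Matrix (Fin d) (Fin d) ℝ) (η β θ : ℕ → ℝ) (ε : ℝ)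
    (x₀ : EuclideanSpace ℝ (Fin d)) (k : ℕ → Fin K) : ℕ → State d
  | 0 => { x := x₀, m := 0, v := 0 }
  | t + 1 =>
      let s := run f S η β θ ε x₀ k t
      s.step (η (t + 1)) (β (t + 1)) (θ (t + 1)) ε
        (gradient (gaussSmooth (S (t + 1)) (f (k (t + 1)))) s.x)

end AGSAdam

/-! There are finitely many indices, so the second-moment bound gives a deterministic bound `G =
√(Kλ)` on every sampled gradient. Smoothing averages translates against a Gaussian probability
measure, so it preserves this bound, the Lipschitz constant of the gradient and the lower bound. All
estimates along a trajectory are therefore sure; randomness enters only through the mean of a fresh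
sample.

Let `F_t` be `f` smoothed by `Σ_{t+1}` (parameters shifted likewise), `p_t = ∇F_t(x_t)`, `w_t =
1/√(v_t+ε)`. Up to `O(η_t²)` and the change of smoothing, a step lowers the objective by `η_t A_t`,
where `A_t = ⟨p_t, w_{t+1} m_{t+1}⟩`. This has no sign, but up to `O(η_t + 1 - θ_{t+1})` it
satisfies `A_{t+1} = β_{t+1} A_t + (1-β_{t+1}) Y_{t+1}` with `Y_t = ⟨p_t, w_t g_t⟩`. Weights `γ_t =
η_t + β_{t+1} γ_{t+1}`, comparable to `η_t`, turn `F_t(x_t) - γ_t A_t` into a Lyapunov function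
(`lyapunov_descent`): it drops by `γ_{t+1}(1-β_{t+1}) Y_{t+1}` up to a summable error. Since `Y_t`
uses the old scaling `w_t`, independent of the fresh index, `E Y_t ≥ c E‖p_t‖²`; summing gives `∑
η_t E‖p_t‖² < ∞`.

Hence `∑ η_t ‖p_t‖² < ∞` almost surely. As `‖p_t‖²` moves by only `O(η_t)`,
`tendsto_zero_of_summable_mul` gives `p_t → 0`. Finally `∇f - ∇F_t = O(‖Σ_{t+1}‖)`, and bounded
convergence handles the expectations. -/

namespace AGSAdam

/-! ### Scalar sequences -/

/-- A nonnegative sequence `u` whose increments are `O(a)`, where `∑ a = ∞`, `∑ a² < ∞` and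
`∑ a u < ∞`, tends to `0`. -/
theorem tendsto_zero_of_summable_mul {a u : ℕ → ℝ} (ha : ∀ t, 0 ≤ a t) (hu : ∀ t, 0 ≤ u t)
    (ha2 : Summable fun t => a t ^ 2) (hau : Summable fun t => a t * u t) (hdiv : ¬ Summable a)
    {C : ℝ} (hC : ∀ t, |u (t + 1) - u t| ≤ C * a t) : Tendsto u atTop (𝓝 0) := by
  have hcau : CauchySeq fun t => u t ^ 2 := by
    -- Squares are used because the increment factors as `(u (t+1) + u t)(u (t+1) - u t)`, at most
    -- `(2 u + C a) · C a`, and this is summable.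
    refine cauchySeq_of_dist_le_of_summable (fun t => 2 * C * (a t * u t) + C ^ 2 * a t ^ 2)
      (fun t => ?_) ((hau.mul_left _).add (ha2.mul_left _))
    have h1 := hC t
    have h0 := (abs_nonneg _).trans h1
    have h2 : u (t + 1) + u t ≤ 2 * u t + C * a t := by linarith [le_abs_self (u (t + 1) - u t)]
    have h3 : 0 ≤ u (t + 1) + u t := add_nonneg (hu _) (hu _)
    have h4 : 0 ≤ 2 * u t + C * a t := h3.trans h2
    rw [dist_comm, Real.dist_eq, sq_sub_sq, abs_mul, abs_of_nonneg h3]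
    calc (u (t + 1) + u t) * |u (t + 1) - u t| ≤ (2 * u t + C * a t) * (C * a t) := by gcongr
      _ = _ := by ring
  obtain ⟨l, hl⟩ := cauchySeq_tendsto_of_complete hcau
  have hl0 : 0 ≤ l := ge_of_tendsto' hl fun t => sq_nonneg _
  have hul : Tendsto u atTop (𝓝 (√l)) := by
    simpa only [Real.sqrt_sq (hu _)] using hl.sqrt
  rcases (Real.sqrt_nonneg l).eq_or_lt with h | h
  · rwa [h]
  -- With a positive limit, eventually `u t > √l / 2`, so `∑ a u < ∞` would force `∑ a < ∞`.
  · refine (hdiv ?_).elim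
    refine Summable.of_norm_bounded_eventually_nat (hau.mul_left (2 / √l)) ?_
    filter_upwards [hul.eventually (lt_mem_nhds (half_lt_self h))] with t ht
    rw [Real.norm_of_nonneg (ha t)]
    calc a t = 2 / √l * (a t * (√l / 2)) := by field_simp
      _ ≤ _ := by have := ha t; gcongr

/-- The total weights `γ t = ∑ n, η (t + n) β (t + 1) ⋯ β (t + n)` of the momentum contributions. -/
theorem exists_momentum_weight {η β : ℕ → ℝ} {b C : ℝ} (hη : ∀ t, 0 ≤ η t)
    (hβ : ∀ t, 0 ≤ β t ∧ β t ≤ b) (hb : b < 1) (hmono : ∀ s t, s ≤ t → η t ≤ C * η s) :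
    ∃ γ : ℕ → ℝ, (∀ t, γ t = η t + β (t + 1) * γ (t + 1)) ∧
      ∀ t, η t ≤ γ t ∧ γ t ≤ C / (1 - b) * η t := by
  have hb0 : 0 ≤ b := (hβ 0).1.trans (hβ 0).2
  let w : ℕ → ℕ → ℝ := fun t n => η (t + n) * ∏ i ∈ Finset.range n, β (t + 1 + i)
  have hw0 : ∀ t n, 0 ≤ w t n := fun t n =>
    mul_nonneg (hη _) (Finset.prod_nonneg fun i _ => (hβ _).1)
  have hwle : ∀ t n, w t n ≤ C * η t * b ^ n := by
    intro t n
    have : ∏ i ∈ Finset.range n, β (t + 1 + i) ≤ b ^ n := by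
      simpa using Finset.prod_le_prod (s := Finset.range n) (fun i _ => (hβ (t + 1 + i)).1)
        (fun i _ => (hβ (t + 1 + i)).2)
    exact mul_le_mul (hmono t (t + n) (Nat.le_add_right _ _)) this
      (Finset.prod_nonneg fun i _ => (hβ _).1) ((hη _).trans (hmono t t le_rfl))
  have hgeo := summable_geometric_of_lt_one hb0 hb
  have hsum : ∀ t, Summable (w t) := fun t =>
    Summable.of_nonneg_of_le (hw0 t) (hwle t) (hgeo.mul_left _)
  have hrec : ∀ t, ∑' n, w t n = η t + β (t + 1) * ∑' n, w (t + 1) n := by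
    intro t
    rw [(hsum t).tsum_eq_zero_add, ← tsum_mul_left]
    congr 1
    · simp [w]
    · refine tsum_congr fun n => ?_
      simp only [w, Finset.prod_range_succ', add_zero]
      rw [show t + (n + 1) = t + 1 + n by ring]
      rw [Finset.prod_congr rfl fun i _ => by
        rw [show t + 1 + (i + 1) = t + 1 + 1 + i by ring]]
      ring
  refine ⟨fun t => ∑' n, w t n, hrec, fun t => ⟨?_, ?_⟩⟩
  · have : 0 ≤ β (t + 1) * ∑' n, w (t + 1) n :=
      mul_nonneg (hβ (t + 1)).1 (tsum_nonneg (hw0 (t + 1)))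
    linarith [hrec t]
  · calc ∑' n, w t n ≤ ∑' n, C * η t * b ^ n := (hsum t).tsum_le_tsum (hwle t) (hgeo.mul_left _)
      _ = C / (1 - b) * η t := by
        rw [tsum_mul_left, tsum_geometric_of_lt_one hb0 hb]; ring

/-- If `Φ (t + 1) + c t ≤ Φ t + r t` with `Φ` bounded below, `c ≥ 0` and `r` summable, then `c` is
summable. -/
theorem summable_of_descent {Φ c r : ℕ → ℝ} {M : ℝ} (hM : ∀ t, M ≤ Φ t) (hc : ∀ t, 0 ≤ c t)
    (hr0 : ∀ t, 0 ≤ r t) (hr : Summable r) (h : ∀ t, Φ (t + 1) + c t ≤ Φ t + r t) :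
    Summable c := by
  refine summable_of_sum_range_le (c := Φ 0 - M + ∑' t, r t) hc fun n => ?_
  have key : Φ n + ∑ t ∈ Finset.range n, c t ≤ Φ 0 + ∑ t ∈ Finset.range n, r t := by
    induction n with
    | zero => simp
    | succ n ih => rw [Finset.sum_range_succ, Finset.sum_range_succ]; linarith [h n]
  linarith [hM n, hr.sum_le_tsum (Finset.range n) fun t _ => hr0 t]

/-- Rationalise `√b - √a`. It turns a change of `v` of size `1 - θ` into a change of the scaling of
the same order. -/
theorem abs_inv_sqrt_sub_inv_sqrt_le {a b ε : ℝ} (hε : 0 < ε) (ha : ε ≤ a) (hb : ε ≤ b) :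
    |(√a)⁻¹ - (√b)⁻¹| ≤ |a - b| / (ε * √ε) := by
  have hsε : 0 < √ε := Real.sqrt_pos.2 hε
  have h1 : √ε ≤ √a := Real.sqrt_le_sqrt ha
  have h2 : √ε ≤ √b := Real.sqrt_le_sqrt hb
  have h1' : 0 < √a := hsε.trans_le h1
  have h2' : 0 < √b := hsε.trans_le h2
  have e : |√b - √a| * (√b + √a) = |a - b| := by
    rw [← abs_of_pos (add_pos h2' h1'), ← abs_mul, abs_sub_comm a b]
    congr 1
    nlinarith [Real.mul_self_sqrt (hε.le.trans ha), Real.mul_self_sqrt (hε.le.trans hb)]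
  rw [inv_sub_inv h1'.ne' h2'.ne', abs_div, abs_of_pos (mul_pos h1' h2'), ← e]
  rw [div_le_div_iff₀ (by positivity) (by positivity)]
  have h3 : ε ≤ √a * √b := by
    calc ε = √ε * √ε := (Real.mul_self_sqrt hε.le).symm
      _ ≤ _ := by gcongr
  have h4 : √ε ≤ √b + √a := by linarith
  calc |√b - √a| * (ε * √ε) ≤ |√b - √a| * ((√a * √b) * (√b + √a)) := by gcongr
    _ = _ := by ring

/-! ### Coordinatewise scaling -/

variable {d : ℕ}

/-- The coordinatewise product of two vectors. -/
noncomputable def hadamard (w x : EuclideanSpace ℝ (Fin d)) : EuclideanSpace ℝ (Fin d) :=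
  WithLp.toLp 2 fun i => w i * x i

theorem norm_hadamard_le {δ : ℝ} {w : EuclideanSpace ℝ (Fin d)} (hw : ∀ i, |w i| ≤ δ)
    (x : EuclideanSpace ℝ (Fin d)) : ‖hadamard w x‖ ≤ δ * ‖x‖ := by
  -- For `d = 0` the hypothesis does not give `0 ≤ δ`, but both vectors vanish.
  rcases isEmpty_or_nonempty (Fin d) with h | ⟨⟨i₀⟩⟩
  · rw [Subsingleton.elim (hadamard w x) 0, Subsingleton.elim x 0]; simp
  have hδ : 0 ≤ δ := (abs_nonneg _).trans (hw i₀)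
  refine le_of_sq_le_sq ?_ (by positivity)
  rw [mul_pow, EuclideanSpace.real_norm_sq_eq, EuclideanSpace.real_norm_sq_eq, Finset.mul_sum]
  refine Finset.sum_le_sum fun i _ => ?_
  simp only [hadamard, mul_pow]
  have : w i ^ 2 ≤ δ ^ 2 := sq_le_sq.2 ((hw i).trans (le_abs_self δ))
  gcongr

theorem hadamard_add (w x y : EuclideanSpace ℝ (Fin d)) :
    hadamard w (x + y) = hadamard w x + hadamard w y := by
  ext i; simp [hadamard, mul_add]

theorem hadamard_smul (w x : EuclideanSpace ℝ (Fin d)) (c : ℝ) :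
    hadamard w (c • x) = c • hadamard w x := by
  ext i; simp [hadamard, mul_left_comm]

theorem sub_hadamard (w w' x : EuclideanSpace ℝ (Fin d)) :
    hadamard (w - w') x = hadamard w x - hadamard w' x := by
  ext i; simp [hadamard, sub_mul]

theorem hadamard_sum {ι : Type*} (s : Finset ι) (w : EuclideanSpace ℝ (Fin d))
    (x : ι → EuclideanSpace ℝ (Fin d)) : hadamard w (∑ j ∈ s, x j) = ∑ j ∈ s, hadamard w (x j) := by
  classical
  induction s using Finset.induction_on with
  | empty => ext i; simp [hadamard]
  | insert a s ha ih => rw [Finset.sum_insert ha, Finset.sum_insert ha, hadamard_add, ih]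

theorem mul_norm_sq_le_inner_hadamard {c : ℝ} {w : EuclideanSpace ℝ (Fin d)} (hw : ∀ i, c ≤ w i)
    (x : EuclideanSpace ℝ (Fin d)) : c * ‖x‖ ^ 2 ≤ inner ℝ x (hadamard w x) := by
  rw [EuclideanSpace.real_norm_sq_eq, Finset.mul_sum, PiLp.inner_apply]
  refine Finset.sum_le_sum fun i _ => ?_
  have : inner ℝ (x i) (hadamard w x i) = w i * x i ^ 2 := by simp [hadamard]; ring
  rw [this]
  have := hw i
  gcongr

theorem abs_apply_le_norm (x : EuclideanSpace ℝ (Fin d)) (i : Fin d) : |x i| ≤ ‖x‖ := by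
  simpa using PiLp.norm_apply_le x i

/-! ### Functions with Lipschitz gradient -/

theorem norm_gradient_sub (f g : EuclideanSpace ℝ (Fin d) → ℝ) (x y : EuclideanSpace ℝ (Fin d)) :
    ‖gradient f x - gradient g y‖ = ‖fderiv ℝ f x - fderiv ℝ g y‖ := by
  rw [← toDual_gradient, ← toDual_gradient, ← map_sub, LinearIsometryEquiv.norm_map]

theorem norm_gradient (f : EuclideanSpace ℝ (Fin d) → ℝ) (x : EuclideanSpace ℝ (Fin d)) :
    ‖gradient f x‖ = ‖fderiv ℝ f x‖ := by
  rw [← toDual_gradient, LinearIsometryEquiv.norm_map]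

/-- A quadratic upper bound for functions with Lipschitz gradient. -/
theorem LSmooth.le_add_inner {L : NNReal} {f : EuclideanSpace ℝ (Fin d) → ℝ} (hf : LSmooth L f)
    (x y : EuclideanSpace ℝ (Fin d)) :
    f y ≤ f x + inner ℝ (gradient f x) (y - x) + L * ‖y - x‖ ^ 2 := by
  -- Mean value inequality for `f` minus its linearisation at `x`; this gives the constant `L`
  -- instead of `L / 2`, which suffices.
  have h := (convex_segment (𝕜 := ℝ) x y).norm_image_sub_le_of_norm_hasFDerivWithin_le'
    (f := f) (f' := fderiv ℝ f) (φ := fderiv ℝ f x) (C := L * ‖y - x‖)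
    (fun z _ => (hf.1 z).hasFDerivAt.hasFDerivWithinAt) (fun z hz => ?_)
    (left_mem_segment ℝ x y) (right_mem_segment ℝ x y)
  · have h' := (le_abs_self _).trans h
    rw [inner_gradient_left]
    linarith [sq ‖y - x‖]
  · rw [← norm_gradient_sub, ← dist_eq_norm]
    refine (hf.2.dist_le_mul z x).trans ?_
    gcongr
    rw [dist_eq_norm]
    obtain ⟨a, b, ha, hb, hab, rfl⟩ := hz
    have : a • x + b • y - x = b • (y - x) := by
      rw [← eq_sub_iff_add_eq] at hab
      subst hab
      module
    rw [this, norm_smul, Real.norm_of_nonneg hb]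
    exact mul_le_of_le_one_left (norm_nonneg _) (by linarith)

/-! ### Gaussian smoothing -/

/-- The density `π^{-d/2} exp(-‖u‖²)`. -/
noncomputable def gaussDensity (d : ℕ) (u : EuclideanSpace ℝ (Fin d)) : NNReal :=
  Real.toNNReal (1 / Real.pi ^ ((d : ℝ) / 2) * Real.exp (-‖u‖ ^ 2))

/-- The Gaussian probability measure with density `π^{-d/2} exp(-‖u‖²)`. -/
noncomputable def gaussMeasure (d : ℕ) : Measure (EuclideanSpace ℝ (Fin d)) :=
  volume.withDensity fun u => gaussDensity d u

theorem coe_gaussDensity (u : EuclideanSpace ℝ (Fin d)) :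
    (gaussDensity d u : ℝ) = 1 / Real.pi ^ ((d : ℝ) / 2) * Real.exp (-‖u‖ ^ 2) :=
  Real.coe_toNNReal _ (by positivity)

theorem measurable_gaussDensity : Measurable (gaussDensity d) := by
  unfold gaussDensity; fun_prop

theorem integrable_exp_neg_mul_norm_sq {b : ℝ} (hb : 0 < b) :
    Integrable fun u : EuclideanSpace ℝ (Fin d) => Real.exp (-b * ‖u‖ ^ 2) := by
  by_contra h
  have h1 := GaussianFourier.integral_rexp_neg_mul_sq_norm (V := EuclideanSpace ℝ (Fin d)) hb
  -- A non-integrable function has integral `0` by convention, whereas the Gaussian integral is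
  -- positive.
  rw [integral_undef h] at h1
  have : 0 < Real.pi / b := by positivity
  exact (Real.rpow_pos_of_pos this _).ne h1

instance isProbabilityMeasure_gaussMeasure : IsProbabilityMeasure (gaussMeasure d) := by
  constructor
  have h1 := integrable_exp_neg_mul_norm_sq (d := d) one_pos
  have h2 := GaussianFourier.integral_rexp_neg_mul_sq_norm (V := EuclideanSpace ℝ (Fin d)) one_pos
  simp only [neg_mul, one_mul, finrank_euclideanSpace, Fintype.card_fin, div_one] at h1 h2
  rw [gaussMeasure, withDensity_apply _ MeasurableSet.univ, Measure.restrict_univ]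
  unfold gaussDensity
  change ∫⁻ u : EuclideanSpace ℝ (Fin d),
    ENNReal.ofReal (1 / Real.pi ^ ((d : ℝ) / 2) * Real.exp (-‖u‖ ^ 2)) = 1
  rw [← ofReal_integral_eq_lintegral_ofReal (h1.const_mul _)
    (Eventually.of_forall fun u => by positivity), integral_const_mul, h2, one_div,
    inv_mul_cancel₀ (Real.rpow_pos_of_pos Real.pi_pos _).ne', ENNReal.ofReal_one]

theorem integrable_norm_gaussMeasure :
    Integrable (fun u : EuclideanSpace ℝ (Fin d) => ‖u‖) (gaussMeasure d) := by
  rw [gaussMeasure, integrable_withDensity_iff_integrable_coe_smul measurable_gaussDensity]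
  simp only [coe_gaussDensity, smul_eq_mul, mul_assoc]
  refine Integrable.const_mul ?_ _
  refine (integrable_exp_neg_mul_norm_sq (d := d) one_half_pos).mono' (by fun_prop)
    (Eventually.of_forall fun u => ?_)
  rw [Real.norm_of_nonneg (by positivity)]
  -- Half of the Gaussian exponent is spent on absorbing the linear factor.
  have h : ‖u‖ ≤ Real.exp (1 / 2 * ‖u‖ ^ 2) := by
    nlinarith [Real.add_one_le_exp (1 / 2 * ‖u‖ ^ 2), sq_nonneg (‖u‖ - 1)]
  calc Real.exp (-‖u‖ ^ 2) * ‖u‖ ≤ Real.exp (-‖u‖ ^ 2) * Real.exp (1 / 2 * ‖u‖ ^ 2) := by gcongr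
    _ = _ := by rw [← Real.exp_add]; congr 1; ring

theorem gaussSmooth_eq_integral (S : Matrix (Fin d) (Fin d) ℝ) (g : EuclideanSpace ℝ (Fin d) → ℝ)
    (x : EuclideanSpace ℝ (Fin d)) :
    gaussSmooth S g x =
      ∫ u, g (x + Matrix.toEuclideanCLM (n := Fin d) (𝕜 := ℝ) S u) ∂gaussMeasure d := by
  rw [gaussMeasure, integral_withDensity_eq_integral_smul measurable_gaussDensity, gaussSmooth,
    ← integral_const_mul]
  congr 1
  ext u
  rw [NNReal.smul_def, coe_gaussDensity, smul_eq_mul]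
  ring

variable {g : EuclideanSpace ℝ (Fin d) → ℝ} {G : ℝ}

theorem abs_sub_le_of_norm_gradient_le (hg : Differentiable ℝ g) (hG : ∀ x, ‖gradient g x‖ ≤ G)
    (x y : EuclideanSpace ℝ (Fin d)) : |g y - g x| ≤ G * ‖y - x‖ :=
  convex_univ.norm_image_sub_le_of_norm_fderiv_le (fun z _ => hg z)
    (fun z _ => (norm_gradient g z).symm.trans_le (hG z)) (Set.mem_univ x) (Set.mem_univ y)

theorem integrable_comp_toEuclideanCLM (hg : Differentiable ℝ g) (hG : ∀ x, ‖gradient g x‖ ≤ G)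
    (S : Matrix (Fin d) (Fin d) ℝ) (x : EuclideanSpace ℝ (Fin d)) :
    Integrable (fun u => g (x + Matrix.toEuclideanCLM (n := Fin d) (𝕜 := ℝ) S u))
      (gaussMeasure d) := by
  have hG0 : 0 ≤ G := (norm_nonneg _).trans (hG 0)
  refine ((integrable_const |g x|).add (integrable_norm_gaussMeasure.const_mul
    (G * matOpNorm S))).mono' ?_ (Eventually.of_forall fun u => ?_)
  · have := hg.continuous
    exact Continuous.aestronglyMeasurable (by fun_prop)
  · have h1 := abs_sub_le_of_norm_gradient_le hg hG x
      (x + Matrix.toEuclideanCLM (n := Fin d) (𝕜 := ℝ) S u)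
    rw [add_sub_cancel_left] at h1
    have h2 := (Matrix.toEuclideanCLM (n := Fin d) (𝕜 := ℝ) S).le_opNorm u
    have h3 := mul_le_mul_of_nonneg_left h2 hG0
    rw [Real.norm_eq_abs, Pi.add_apply, matOpNorm, mul_assoc]
    have h4 := abs_sub_abs_le_abs_sub
      (g (x + Matrix.toEuclideanCLM (n := Fin d) (𝕜 := ℝ) S u)) (g x)
    linarith

/-- Differentiation under the integral sign. -/
theorem hasFDerivAt_gaussSmooth (hg : Differentiable ℝ g) (hG : ∀ x, ‖gradient g x‖ ≤ G)
    (S : Matrix (Fin d) (Fin d) ℝ) (x : EuclideanSpace ℝ (Fin d)) :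
    Integrable (fun u => fderiv ℝ g (x + Matrix.toEuclideanCLM (n := Fin d) (𝕜 := ℝ) S u))
      (gaussMeasure d) ∧
    HasFDerivAt (gaussSmooth S g)
      (∫ u, fderiv ℝ g (x + Matrix.toEuclideanCLM (n := Fin d) (𝕜 := ℝ) S u) ∂gaussMeasure d) x := by
  rw [show gaussSmooth S g = _ from funext (gaussSmooth_eq_integral S g)]
  refine hasFDerivAt_integral_of_dominated_loc_of_lip' (s := Set.univ) (bound := fun _ => G)
    univ_mem (fun y _ => (integrable_comp_toEuclideanCLM hg hG S y).1)
    (integrable_comp_toEuclideanCLM hg hG S x) ?_ (Eventually.of_forall fun u y _ => ?_)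
    (integrable_const _) (Eventually.of_forall fun u => ?_)
  -- The gradient of `g` need not be continuous, but a derivative is always measurable.
  · refine Measurable.aestronglyMeasurable ?_
    exact (measurable_fderiv ℝ g).comp (by fun_prop)
  · have := abs_sub_le_of_norm_gradient_le hg hG
      (x + Matrix.toEuclideanCLM (n := Fin d) (𝕜 := ℝ) S u)
      (y + Matrix.toEuclideanCLM (n := Fin d) (𝕜 := ℝ) S u)
    rwa [add_sub_add_right_eq_sub] at this
  · exact (hasFDerivAt_comp_add_right _).2 (hg _).hasFDerivAt

theorem differentiable_gaussSmooth (hg : Differentiable ℝ g) (hG : ∀ x, ‖gradient g x‖ ≤ G)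
    (S : Matrix (Fin d) (Fin d) ℝ) : Differentiable ℝ (gaussSmooth S g) := fun x =>
  (hasFDerivAt_gaussSmooth hg hG S x).2.differentiableAt

theorem norm_gradient_gaussSmooth_le (hg : Differentiable ℝ g) (hG : ∀ x, ‖gradient g x‖ ≤ G)
    (S : Matrix (Fin d) (Fin d) ℝ) (x : EuclideanSpace ℝ (Fin d)) :
    ‖gradient (gaussSmooth S g) x‖ ≤ G := by
  rw [norm_gradient, (hasFDerivAt_gaussSmooth hg hG S x).2.fderiv]
  refine (norm_integral_le_of_norm_le_const (C := G) (Eventually.of_forall fun u => ?_)).trans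
    (by simp)
  rw [← norm_gradient]
  exact hG _

/-- The smoothed gradient is a probability average of translates of the gradient, which share one
Lipschitz constant. -/
theorem LSmooth.gaussSmooth {L : NNReal} (hg : LSmooth L g) (hG : ∀ x, ‖gradient g x‖ ≤ G)
    (S : Matrix (Fin d) (Fin d) ℝ) : LSmooth L (gaussSmooth S g) := by
  refine ⟨differentiable_gaussSmooth hg.1 hG S, LipschitzWith.of_dist_le_mul fun x y => ?_⟩
  have hx := hasFDerivAt_gaussSmooth hg.1 hG S x
  have hy := hasFDerivAt_gaussSmooth hg.1 hG S y
  rw [dist_eq_norm, norm_gradient_sub, hx.2.fderiv, hy.2.fderiv, ← integral_sub hx.1 hy.1]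
  refine (norm_integral_le_of_norm_le_const (C := L * dist x y)
    (Eventually.of_forall fun u => ?_)).trans (by simp)
  rw [← norm_gradient_sub, ← dist_eq_norm]
  simpa using hg.2.dist_le_mul (x + Matrix.toEuclideanCLM (n := Fin d) (𝕜 := ℝ) S u)
      (y + Matrix.toEuclideanCLM (n := Fin d) (𝕜 := ℝ) S u)

theorem norm_gradient_gaussSmooth_sub_le {L : NNReal} (hg : LSmooth L g)
    (hG : ∀ x, ‖gradient g x‖ ≤ G) (S : Matrix (Fin d) (Fin d) ℝ) (x : EuclideanSpace ℝ (Fin d)) :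
    ‖gradient (AGSAdam.gaussSmooth S g) x - gradient g x‖ ≤
      L * (∫ u, ‖u‖ ∂gaussMeasure d) * matOpNorm S := by
  have hx := hasFDerivAt_gaussSmooth hg.1 hG S x
  have hc : fderiv ℝ g x = ∫ _u, fderiv ℝ g x ∂gaussMeasure d := by simp
  rw [norm_gradient_sub, hx.2.fderiv, hc, ← integral_sub hx.1 (integrable_const _)]
  have hb : Integrable (fun u => L * matOpNorm S * ‖u‖) (gaussMeasure d) :=
    integrable_norm_gaussMeasure.const_mul _
  refine (norm_integral_le_of_norm_le hb (Eventually.of_forall fun u => ?_)).trans_eq ?_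
  · rw [← norm_gradient_sub, ← dist_eq_norm]
    refine (hg.2.dist_le_mul _ _).trans ?_
    rw [mul_assoc]
    gcongr
    simpa [matOpNorm] using (Matrix.toEuclideanCLM (n := Fin d) (𝕜 := ℝ) S).le_opNorm u
  · rw [integral_const_mul]; ring

theorem le_gaussSmooth (hg : Differentiable ℝ g) (hG : ∀ x, ‖gradient g x‖ ≤ G) {m : ℝ}
    (hm : ∀ x, m ≤ g x) (S : Matrix (Fin d) (Fin d) ℝ) (x : EuclideanSpace ℝ (Fin d)) :
    m ≤ gaussSmooth S g x := by
  rw [gaussSmooth_eq_integral]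
  calc m = ∫ _u, m ∂gaussMeasure d := by simp
    _ ≤ _ := integral_mono (integrable_const _) (integrable_comp_toEuclideanCLM hg hG S x)
      fun u => hm _

/-- The gradient of the smoothing of a mean is the mean of the gradients of the smoothings. -/
theorem gradient_gaussSmooth_mean {K : ℕ} {fk : Fin K → EuclideanSpace ℝ (Fin d) → ℝ}
    {f : EuclideanSpace ℝ (Fin d) → ℝ} (hfk : ∀ j, Differentiable ℝ (fk j))
    (hG : ∀ j x, ‖gradient (fk j) x‖ ≤ G) (h_mean : ∀ x, (1 / (K : ℝ)) * ∑ j, fk j x = f x)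
    (S : Matrix (Fin d) (Fin d) ℝ) (x : EuclideanSpace ℝ (Fin d)) :
    gradient (gaussSmooth S f) x =
      (1 / (K : ℝ)) • ∑ j, gradient (gaussSmooth S (fk j)) x := by
  have h1 : gaussSmooth S f = fun y => (1 / (K : ℝ)) * ∑ j, gaussSmooth S (fk j) y := by
    ext y
    simp only [gaussSmooth_eq_integral]
    rw [← integral_finsetSum _ fun j _ => integrable_comp_toEuclideanCLM (hfk j) (hG j) S y,
      ← integral_const_mul]
    simp only [h_mean]
  have hd := fun j => (differentiable_gaussSmooth (hfk j) (hG j) S x).hasFDerivAt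
  have h2 : HasFDerivAt (gaussSmooth S f)
      ((1 / (K : ℝ)) • ∑ j, fderiv ℝ (gaussSmooth S (fk j)) x) x := by
    rw [h1]
    exact (HasFDerivAt.fun_sum fun j _ => hd j).const_mul _
  apply (InnerProductSpace.toDual ℝ (EuclideanSpace ℝ (Fin d))).injective
  rw [toDual_gradient, h2.fderiv]
  ext y
  simp

/-! ### Trajectories of the Adam recursion -/

/-- The coordinatewise scaling `1 / √(v + ε)`. -/
noncomputable def invSqrt (ε : ℝ) (v : EuclideanSpace ℝ (Fin d)) : EuclideanSpace ℝ (Fin d) :=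
  WithLp.toLp 2 fun i => (√(v i + ε))⁻¹

/-- The a priori bounds on the moments of the algorithm when all samples have norm at most `G`. -/
structure State.Bounded (G : ℝ) (s : State d) : Prop where
  norm_m_le : ‖s.m‖ ≤ G
  v_nonneg : ∀ i, 0 ≤ s.v i
  v_le : ∀ i, s.v i ≤ G ^ 2

/-! ### Bounds for a single update -/

section Step

variable {η β θ ε G : ℝ} {s : State d} {g : EuclideanSpace ℝ (Fin d)}

theorem State.step_x : (s.step η β θ ε g).x =
    s.x - η • hadamard (invSqrt ε (s.step η β θ ε g).v) (s.step η β θ ε g).m := by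
  ext i
  simp [State.step, hadamard, invSqrt, div_eq_inv_mul]

theorem State.step_m : (s.step η β θ ε g).m = β • s.m + (1 - β) • g := rfl

theorem State.step_v (i : Fin d) : (s.step η β θ ε g).v i = θ * s.v i + (1 - θ) * g i ^ 2 := by
  simp [State.step]

theorem sq_apply_le (hg : ‖g‖ ≤ G) (i : Fin d) : g i ^ 2 ≤ G ^ 2 :=
  sq_le_sq.2 ((abs_apply_le_norm g i).trans (hg.trans (le_abs_self G)))

theorem State.Bounded.step (hs : s.Bounded G) (hβ : 0 ≤ β ∧ β ≤ 1) (hθ : 0 ≤ θ ∧ θ ≤ 1)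
    (hg : ‖g‖ ≤ G) : (s.step η β θ ε g).Bounded G where
  norm_m_le := by
    rw [State.step_m]
    refine (norm_add_le _ _).trans ?_
    rw [norm_smul, norm_smul, Real.norm_of_nonneg hβ.1, Real.norm_of_nonneg (sub_nonneg.2 hβ.2)]
    nlinarith [mul_le_mul_of_nonneg_left hs.norm_m_le hβ.1,
      mul_le_mul_of_nonneg_left hg (sub_nonneg.2 hβ.2)]
  v_nonneg i := by
    rw [State.step_v]
    exact add_nonneg (mul_nonneg hθ.1 (hs.v_nonneg i))
      (mul_nonneg (sub_nonneg.2 hθ.2) (sq_nonneg _))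
  v_le i := by
    rw [State.step_v]
    nlinarith [mul_le_mul_of_nonneg_left (hs.v_le i) hθ.1,
      mul_le_mul_of_nonneg_left (sq_apply_le hg i) (sub_nonneg.2 hθ.2)]

theorem State.Bounded.abs_invSqrt_le (hs : s.Bounded G) (hε : 0 < ε) (i : Fin d) :
    |invSqrt ε s.v i| ≤ (√ε)⁻¹ := by
  have := hs.v_nonneg i
  have h : √ε ≤ √(s.v i + ε) := Real.sqrt_le_sqrt (by linarith)
  have h0 : 0 < √ε := Real.sqrt_pos.2 hε
  simp only [invSqrt]
  rw [abs_of_nonneg (by positivity)]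
  gcongr

theorem State.Bounded.le_invSqrt (hs : s.Bounded G) (hε : 0 < ε) (i : Fin d) :
    (√(G ^ 2 + ε))⁻¹ ≤ invSqrt ε s.v i := by
  have h0 := hs.v_nonneg i
  have h1 : 0 < √(s.v i + ε) := Real.sqrt_pos.2 (by linarith)
  have h2 := hs.v_le i
  simp only [invSqrt]
  gcongr

theorem State.Bounded.norm_hadamard_invSqrt_le (hs : s.Bounded G) (hε : 0 < ε)
    {y : EuclideanSpace ℝ (Fin d)} (hy : ‖y‖ ≤ G) : ‖hadamard (invSqrt ε s.v) y‖ ≤ G / √ε := by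
  refine (norm_hadamard_le (hs.abs_invSqrt_le hε) y).trans ?_
  rw [div_eq_inv_mul]
  gcongr

/-- One update moves `v i` by `(1 - θ)(g i ^ 2 - v i)`, and both terms in the difference lie in `[0,
G ^ 2]`. -/
theorem State.Bounded.abs_invSqrt_step_sub_le (hs : s.Bounded G) (hε : 0 < ε)
    (hθ : 0 ≤ θ ∧ θ ≤ 1) (hg : ‖g‖ ≤ G) (i : Fin d) :
    |(invSqrt ε (s.step η β θ ε g).v - invSqrt ε s.v) i| ≤ G ^ 2 / (ε * √ε) * (1 - θ) := by
  have h0 := hs.v_nonneg i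
  have h1 := sq_apply_le hg i
  have h2 := hs.v_le i
  have hθ1 := sub_nonneg.2 hθ.2
  have h3 : 0 ≤ (s.step η β θ ε g).v i := by
    rw [State.step_v]
    exact add_nonneg (mul_nonneg hθ.1 h0) (mul_nonneg hθ1 (sq_nonneg _))
  have h4 := abs_inv_sqrt_sub_inv_sqrt_le hε (a := (s.step η β θ ε g).v i + ε) (b := s.v i + ε)
    (by linarith) (by linarith)
  refine h4.trans ?_
  rw [div_mul_eq_mul_div]
  gcongr
  rw [add_sub_add_right_eq_sub, State.step_v,
    show θ * s.v i + (1 - θ) * g i ^ 2 - s.v i = (g i ^ 2 - s.v i) * (1 - θ) by ring, abs_mul,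
    abs_of_nonneg hθ1]
  gcongr
  rw [abs_le]
  constructor <;> linarith [sq_nonneg (g i)]

end Step

/-- A trajectory of the Adam recursion with samples `g t`, used to minimize slowly varying
objectives `F t`. -/
structure AdamPath (F : ℕ → EuclideanSpace ℝ (Fin d) → ℝ) (η β θ : ℕ → ℝ) (ε G M : ℝ) (L : NNReal)
    (R : ℕ → State d) (g : ℕ → EuclideanSpace ℝ (Fin d)) : Prop where
  ε_pos : 0 < ε
  η_pos : ∀ t, 0 < η t
  β_mem : ∀ t, 0 ≤ β t ∧ β t ≤ 1
  θ_mem : ∀ t, 0 ≤ θ t ∧ θ t ≤ 1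
  G_nonneg : 0 ≤ G
  lsmooth : ∀ t, LSmooth L (F t)
  norm_gradient_le : ∀ t x, ‖gradient (F t) x‖ ≤ G
  norm_gradient_sub_le : ∀ t x, ‖gradient (F (t + 1)) x - gradient (F t) x‖ ≤ M * η t
  m_zero : (R 0).m = 0
  v_zero : (R 0).v = 0
  succ : ∀ t, R (t + 1) = (R t).step (η t) (β t) (θ t) ε (g t)
  norm_sample_le : ∀ t, ‖g t‖ ≤ G

/-- The inner product of the gradient of the objective with the update direction. -/
noncomputable def alignment (F : ℕ → EuclideanSpace ℝ (Fin d) → ℝ) (ε : ℝ) (R : ℕ → State d)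
    (t : ℕ) : ℝ :=
  inner ℝ (gradient (F t) (R t).x) (hadamard (invSqrt ε (R (t + 1)).v) (R (t + 1)).m)

/-- The inner product of the gradient of the objective with the previously scaled sample. -/
noncomputable def sampleAlignment (F : ℕ → EuclideanSpace ℝ (Fin d) → ℝ) (ε : ℝ) (R : ℕ → State d)
    (g : ℕ → EuclideanSpace ℝ (Fin d)) (t : ℕ) : ℝ :=
  inner ℝ (gradient (F t) (R t).x) (hadamard (invSqrt ε (R t).v) (g t))

/-! ### Deterministic estimates along one trajectory -/

namespace AdamPath

variable {F : ℕ → EuclideanSpace ℝ (Fin d) → ℝ} {η β θ : ℕ → ℝ} {ε G M : ℝ} {L : NNReal}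
  {R : ℕ → State d} {g : ℕ → EuclideanSpace ℝ (Fin d)}

theorem bounded (h : AdamPath F η β θ ε G M L R g) (t : ℕ) : (R t).Bounded G := by
  induction t with
  | zero =>
    exact ⟨by simp [h.m_zero, h.G_nonneg], by simp [h.v_zero], by simp [h.v_zero, sq_nonneg]⟩
  | succ t ih => rw [h.succ]; exact ih.step (h.β_mem t) (h.θ_mem t) (h.norm_sample_le t)

theorem x_succ (h : AdamPath F η β θ ε G M L R g) (t : ℕ) :
    (R (t + 1)).x = (R t).x - η t • hadamard (invSqrt ε (R (t + 1)).v) (R (t + 1)).m := by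
  rw [h.succ]; exact State.step_x

theorem norm_x_sub_le (h : AdamPath F η β θ ε G M L R g) (t : ℕ) :
    ‖(R (t + 1)).x - (R t).x‖ ≤ G / √ε * η t := by
  rw [h.x_succ, sub_sub_cancel_left, norm_neg, norm_smul, Real.norm_of_nonneg (h.η_pos t).le,
    mul_comm]
  have h1 := (h.bounded (t + 1)).norm_hadamard_invSqrt_le h.ε_pos (h.bounded (t + 1)).norm_m_le
  have h2 := (h.η_pos t).le
  gcongr

theorem norm_gradient_succ_sub_le (h : AdamPath F η β θ ε G M L R g) (t : ℕ) :
    ‖gradient (F (t + 1)) (R (t + 1)).x - gradient (F t) (R t).x‖ ≤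
      (M + L * (G / √ε)) * η t := by
  refine (norm_sub_le_norm_sub_add_norm_sub _ (gradient (F t) (R (t + 1)).x) _).trans ?_
  rw [add_mul, mul_assoc]
  refine add_le_add (h.norm_gradient_sub_le t _) ?_
  rw [← dist_eq_norm]
  refine ((h.lsmooth t).2.dist_le_mul _ _).trans ?_
  rw [dist_eq_norm]
  have := h.norm_x_sub_le t
  gcongr

theorem abs_sq_norm_gradient_succ_sub_le (h : AdamPath F η β θ ε G M L R g) (t : ℕ) :
    |‖gradient (F (t + 1)) (R (t + 1)).x‖ ^ 2 - ‖gradient (F t) (R t).x‖ ^ 2| ≤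
      2 * G * (M + L * (G / √ε)) * η t := by
  rw [sq_sub_sq, abs_mul, abs_of_nonneg (by positivity), mul_assoc]
  have h1 := h.norm_gradient_le (t + 1) (R (t + 1)).x
  have h2 := h.norm_gradient_le t (R t).x
  have h3 := (abs_norm_sub_norm_le _ _).trans (h.norm_gradient_succ_sub_le t)
  have := h.G_nonneg
  gcongr
  linarith

theorem abs_alignment_le (h : AdamPath F η β θ ε G M L R g) (t : ℕ) :
    |alignment F ε R t| ≤ G * (G / √ε) := by
  refine (abs_real_inner_le_norm _ _).trans ?_
  have := h.G_nonneg
  exact mul_le_mul (h.norm_gradient_le t _)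
    ((h.bounded (t + 1)).norm_hadamard_invSqrt_le h.ε_pos (h.bounded (t + 1)).norm_m_le)
    (norm_nonneg _) this

/-- The alignment satisfies the momentum recursion up to a small error. -/
theorem abs_alignment_succ_sub_le (h : AdamPath F η β θ ε G M L R g) (t : ℕ) :
    |alignment F ε R (t + 1) - (β (t + 1) * alignment F ε R t +
        (1 - β (t + 1)) * sampleAlignment F ε R g (t + 1))| ≤
      (M + L * (G / √ε)) * (G / √ε) * η t + G ^ 4 / (ε * √ε) * (1 - θ (t + 1)) := by
  have hG := h.G_nonneg
  have hε : 0 < √ε := Real.sqrt_pos.2 h.ε_pos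
  set p := gradient (F t) (R t).x with hp
  set p' := gradient (F (t + 1)) (R (t + 1)).x with hp'
  set w := invSqrt ε (R (t + 1)).v with hw
  set w' := invSqrt ε (R (t + 2)).v with hw'
  have hm : (R (t + 2)).m = β (t + 1) • (R (t + 1)).m + (1 - β (t + 1)) • g (t + 1) := by
    rw [h.succ (t + 1)]; rfl
  -- The recursion is exact when gradient and scaling are frozen. The two error terms come from
  -- moving the gradient in the old momentum part (order `η t`) and from updating the scaling (order
  -- `1 - θ (t + 1)`).
  have e : alignment F ε R (t + 1) - (β (t + 1) * alignment F ε R t +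
        (1 - β (t + 1)) * sampleAlignment F ε R g (t + 1)) =
      β (t + 1) * inner ℝ (p' - p) (hadamard w (R (t + 1)).m) +
        inner ℝ p' (hadamard (w' - w) (R (t + 2)).m) := by
    rw [sub_hadamard, inner_sub_right, inner_sub_left]
    have : inner ℝ p' (hadamard w (R (t + 2)).m) =
        β (t + 1) * inner ℝ p' (hadamard w (R (t + 1)).m) +
          (1 - β (t + 1)) * inner ℝ p' (hadamard w (g (t + 1))) := by
      rw [hm, hadamard_add, hadamard_smul, hadamard_smul, inner_add_right, inner_smul_right,
        inner_smul_right]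
    rw [this]
    simp only [alignment, sampleAlignment, ← hp, ← hp', ← hw, ← hw']
    ring
  rw [e]
  refine (abs_add_le _ _).trans (add_le_add ?_ ?_)
  · rw [abs_mul, abs_of_nonneg (h.β_mem _).1]
    refine (mul_le_of_le_one_left (abs_nonneg _) (h.β_mem _).2).trans ?_
    refine (abs_real_inner_le_norm _ _).trans ?_
    rw [mul_right_comm]
    exact mul_le_mul (h.norm_gradient_succ_sub_le t)
      ((h.bounded (t + 1)).norm_hadamard_invSqrt_le h.ε_pos (h.bounded (t + 1)).norm_m_le)
      (norm_nonneg _) ((norm_nonneg _).trans (h.norm_gradient_succ_sub_le t))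
  · refine (abs_real_inner_le_norm _ _).trans ?_
    have h1 : ∀ i, |(w' - w) i| ≤ G ^ 2 / (ε * √ε) * (1 - θ (t + 1)) := by
      intro i
      rw [hw', hw, h.succ (t + 1)]
      exact (h.bounded (t + 1)).abs_invSqrt_step_sub_le h.ε_pos (h.θ_mem _) (h.norm_sample_le _) i
    have h2 : 0 ≤ G ^ 2 / (ε * √ε) * (1 - θ (t + 1)) := by
      have := sub_nonneg.2 (h.θ_mem (t + 1)).2
      have := h.ε_pos
      positivity
    calc ‖p'‖ * ‖hadamard (w' - w) (R (t + 2)).m‖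
        ≤ G * (G ^ 2 / (ε * √ε) * (1 - θ (t + 1)) * G) := by
          refine mul_le_mul (h.norm_gradient_le _ _) ?_ (norm_nonneg _) hG
          exact (norm_hadamard_le h1 _).trans
            (mul_le_mul_of_nonneg_left (h.bounded (t + 2)).norm_m_le h2)
      _ = _ := by ring

/-- The decrease of the Lyapunov function `F t (x t) - γ t * alignment t`. -/
theorem lyapunov_descent (h : AdamPath F η β θ ε G M L R g) {γ : ℕ → ℝ} {D : ℝ} {b : ℕ → ℝ}
    (hγ : ∀ t, γ t = η t + β (t + 1) * γ (t + 1)) (hγη : ∀ t, η t ≤ γ t ∧ γ t ≤ D * η t)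
    (hb : ∀ t x, F (t + 1) x ≤ F t x + b t) (t : ℕ) :
    F (t + 1) (R (t + 1)).x - γ (t + 1) * alignment F ε R (t + 1) +
        γ (t + 1) * (1 - β (t + 1)) * sampleAlignment F ε R g (t + 1) ≤
      F t (R t).x - γ t * alignment F ε R t +
        (D * η (t + 1) * ((M + L * (G / √ε)) * (G / √ε) * η t +
          G ^ 4 / (ε * √ε) * (1 - θ (t + 1))) + L * (G / √ε) ^ 2 * η t ^ 2 + b t) := by
  have h1 := (h.lsmooth t).le_add_inner (R t).x (R (t + 1)).x
  have h2 : inner ℝ (gradient (F t) (R t).x) ((R (t + 1)).x - (R t).x) =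
      -(η t * alignment F ε R t) := by
    rw [h.x_succ, sub_sub_cancel_left, inner_neg_right, inner_smul_right]; rfl
  have h3 : L * ‖(R (t + 1)).x - (R t).x‖ ^ 2 ≤ L * (G / √ε) ^ 2 * η t ^ 2 := by
    rw [mul_assoc, ← mul_pow]
    have := h.norm_x_sub_le t
    gcongr
  have h4 := hb t (R (t + 1)).x
  have h5 := h.abs_alignment_succ_sub_le t
  have h6 : 0 ≤ γ (t + 1) := (h.η_pos _).le.trans (hγη _).1
  have h7 := mul_le_mul (hγη (t + 1)).2 h5 (abs_nonneg _) (h6.trans (hγη _).2)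
  have h8 := mul_le_mul_of_nonneg_left (neg_abs_le (alignment F ε R (t + 1) -
    (β (t + 1) * alignment F ε R t + (1 - β (t + 1)) * sampleAlignment F ε R g (t + 1)))) h6
  rw [h2] at h1
  -- The recursion for `γ` is chosen for this: the descent term and the inherited momentum term add
  -- up to `γ t * alignment`.
  have h9 : γ t * alignment F ε R t = η t * alignment F ε R t +
    β (t + 1) * γ (t + 1) * alignment F ε R t := by rw [hγ t]; ring
  linarith

end AdamPath

/-! ### Almost sure convergence of random trajectories -/

/-- By Tonelli the sum of the series has finite expectation, hence is finite almost everywhere. -/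
theorem ae_summable_of_summable_integral {Ω : Type*} [MeasurableSpace Ω] {P : Measure Ω}
    {u : ℕ → Ω → ℝ} (h0 : ∀ t ω, 0 ≤ u t ω) (hint : ∀ t, Integrable (u t) P)
    (hsum : Summable fun t => ∫ ω, u t ω ∂P) : ∀ᵐ ω ∂P, Summable fun t => u t ω := by
  have hm : ∀ t, AEMeasurable (fun ω => ENNReal.ofReal (u t ω)) P := fun t =>
    (hint t).1.aemeasurable.ennreal_ofReal
  have h1 : ∫⁻ ω, ∑' t, ENNReal.ofReal (u t ω) ∂P ≠ ⊤ := by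
    rw [lintegral_tsum hm]
    simp_rw [← ofReal_integral_eq_lintegral_ofReal (hint _) (Eventually.of_forall (h0 _))]
    rw [← ENNReal.ofReal_tsum_of_nonneg (fun t => integral_nonneg (h0 t)) hsum]
    exact ENNReal.ofReal_ne_top
  filter_upwards [ae_lt_top' (AEMeasurable.tsum hm) h1] with ω hω
  simpa [ENNReal.toReal_ofReal (h0 _ _)] using ENNReal.summable_toReal hω.ne

theorem summable_integral_sq_norm_gradient {Ω : Type*} [MeasurableSpace Ω] {P : Measure Ω}
    [IsProbabilityMeasure P] {F : ℕ → EuclideanSpace ℝ (Fin d) → ℝ} {η β θ : ℕ → ℝ}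
    {ε G M : ℝ} {L : NNReal} {R : Ω → ℕ → State d} {g : Ω → ℕ → EuclideanSpace ℝ (Fin d)}
    (h : ∀ ω, AdamPath F η β θ ε G M L (R ω) (g ω))
    {βbar C c m : ℝ} {b : ℕ → ℝ} (hβ : ∀ t, β t ≤ βbar) (hβbar : βbar < 1)
    (hmono : ∀ s t, s ≤ t → η t ≤ C * η s) (hη2 : Summable fun t => η t ^ 2)
    (hηθ : Summable fun t => η t * (1 - θ t))
    (hb0 : ∀ t, 0 ≤ b t) (hbsum : Summable b) (hb : ∀ t x, F (t + 1) x ≤ F t x + b t)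
    (hm : ∀ t x, m ≤ F t x) (hM : 0 ≤ M) (hc : 0 < c)
    (hF_int : ∀ t, Integrable (fun ω => F t (R ω t).x) P)
    (hA_int : ∀ t, Integrable (fun ω => alignment F ε (R ω) t) P)
    (hY_int : ∀ t, Integrable (fun ω => sampleAlignment F ε (R ω) (g ω) t) P)
    (hY : ∀ t, c * ∫ ω, ‖gradient (F t) (R ω t).x‖ ^ 2 ∂P ≤
      ∫ ω, sampleAlignment F ε (R ω) (g ω) t ∂P) :
    Summable fun t => ∫ ω, η (t + 1) * ‖gradient (F (t + 1)) (R ω (t + 1)).x‖ ^ 2 ∂P := by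
  obtain ⟨ω₀⟩ : Nonempty Ω := nonempty_of_isProbabilityMeasure P
  have hε := (h ω₀).ε_pos
  have hηpos := (h ω₀).η_pos
  have hβ0 := (h ω₀).β_mem
  have hθ := (h ω₀).θ_mem
  have hG := (h ω₀).G_nonneg
  obtain ⟨γ, hγ, hγη⟩ := exists_momentum_weight (fun t => (hηpos t).le)
    (fun t => ⟨(hβ0 t).1, hβ t⟩) hβbar hmono
  set D := C / (1 - βbar)
  -- The sign of `C` is not assumed; it follows from `0 < η 0 ≤ D * η 0`.
  have hD : 0 ≤ D := by
    have h1 := (hγη 0).1.trans (hγη 0).2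
    by_contra hneg
    nlinarith [hηpos 0]
  have hγ0 : ∀ t, 0 < γ t := fun t => (hηpos t).trans_le (hγη t).1
  have hβ1 : ∀ t, 0 ≤ 1 - β t := fun t => sub_nonneg.2 (hβ0 t).2
  set r : ℕ → ℝ := fun t => D * η (t + 1) * ((M + L * (G / √ε)) * (G / √ε) * η t +
          G ^ 4 / (ε * √ε) * (1 - θ (t + 1))) + L * (G / √ε) ^ 2 * η t ^ 2 + b t with hr
  have hr0 : ∀ t, 0 ≤ r t := by
    intro t
    have h1 := (hηpos t).le
    have h2 := (hηpos (t + 1)).le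
    have h3 := hb0 t
    have h4 := sub_nonneg.2 (hθ (t + 1)).2
    positivity
  have hηη : Summable fun t => η t * η (t + 1) := by
    refine Summable.of_nonneg_of_le (fun t => mul_nonneg (hηpos _).le (hηpos _).le)
      (fun t => ?_) (hη2.add ((summable_nat_add_iff 1).2 hη2))
    nlinarith [sq_nonneg (η t - η (t + 1)), sq_nonneg (η t), sq_nonneg (η (t + 1))]
  have hrsum : Summable r := by
    refine Summable.add (Summable.add ?_ (hη2.mul_left _)) hbsum
    refine ((hηη.mul_left (D * ((M + L * (G / √ε)) * (G / √ε)))).add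
      (((summable_nat_add_iff 1).2 hηθ).mul_left (D * (G ^ 4 / (ε * √ε))))).congr fun t => ?_
    ring
  have hηbdd : ∀ t, γ t ≤ D * (C * η 0) := fun t =>
    (hγη t).2.trans (mul_le_mul_of_nonneg_left (hmono 0 t (Nat.zero_le t)) hD)
  set Φ : ℕ → Ω → ℝ := fun t ω => F t (R ω t).x - γ t * alignment F ε (R ω) t with hΦ
  have hΦint : ∀ t, Integrable (Φ t) P := fun t => (hF_int t).sub ((hA_int t).const_mul _)
  have hΦlow : ∀ t ω, m - D * (C * η 0) * (G * (G / √ε)) ≤ Φ t ω := by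
    intro t ω
    have h2 : γ t * alignment F ε (R ω) t ≤ D * (C * η 0) * (G * (G / √ε)) := by
      refine (mul_le_mul_of_nonneg_left ((le_abs_self _).trans ((h ω).abs_alignment_le t))
        (hγ0 t).le).trans (mul_le_mul_of_nonneg_right (hηbdd t) (by positivity))
    have h3 := hm t (R ω t).x
    simp only [hΦ]
    linarith
  have hYnn : ∀ t, 0 ≤ ∫ ω, sampleAlignment F ε (R ω) (g ω) t ∂P := fun t =>
    (mul_nonneg hc.le (integral_nonneg fun ω => by positivity)).trans (hY t)
  have hsum : Summable fun t => γ (t + 1) * (1 - β (t + 1)) *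
      ∫ ω, sampleAlignment F ε (R ω) (g ω) (t + 1) ∂P := by
    refine summable_of_descent (Φ := fun t => ∫ ω, Φ t ω ∂P)
      (M := m - D * (C * η 0) * (G * (G / √ε))) (fun t => ?_)
      (fun t => mul_nonneg (mul_nonneg (hγ0 _).le (hβ1 _)) (hYnn _)) hr0 hrsum fun t => ?_
    · calc _ = ∫ _ω, (m - D * (C * η 0) * (G * (G / √ε))) ∂P := by simp
        _ ≤ _ := integral_mono (integrable_const _) (hΦint t) (hΦlow t)
    · rw [← integral_const_mul, ← integral_add (hΦint _) ((hY_int _).const_mul _)]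
      calc _ ≤ ∫ ω, (Φ t ω + r t) ∂P :=
            integral_mono ((hΦint _).add ((hY_int _).const_mul _))
              ((hΦint t).add (integrable_const _))
              fun ω => (h ω).lyapunov_descent hγ hγη hb t
        _ = _ := by rw [integral_add (hΦint t) (integrable_const _)]; simp
  · refine Summable.of_nonneg_of_le
      (fun t => integral_nonneg fun ω => mul_nonneg (hηpos _).le (sq_nonneg _)) (fun t => ?_)
      (hsum.mul_left (1 / (c * (1 - βbar))))
    have hb1 : 0 < 1 - βbar := sub_pos.2 hβbar
    have h0 : 0 ≤ ∫ ω, ‖gradient (F (t + 1)) (R ω (t + 1)).x‖ ^ 2 ∂P :=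
      integral_nonneg fun ω => by positivity
    rw [integral_const_mul, one_div_mul_eq_div, le_div_iff₀ (by positivity)]
    -- The uniform bound `βbar < 1` lets the weight `γ (1 - β)` be replaced by a multiple of `η`.
    have h1 : η (t + 1) * (1 - βbar) ≤ γ (t + 1) * (1 - β (t + 1)) :=
      mul_le_mul (hγη _).1 (by linarith [hβ (t + 1)]) hb1.le (hγ0 _).le
    calc _ = η (t + 1) * (1 - βbar) *
          (c * ∫ ω, ‖gradient (F (t + 1)) (R ω (t + 1)).x‖ ^ 2 ∂P) := by ring
      _ ≤ _ := mul_le_mul h1 (hY _) (by positivity) (mul_nonneg (hγ0 _).le (hβ1 _))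

theorem ae_tendsto_sq_norm_gradient {Ω : Type*} [MeasurableSpace Ω] {P : Measure Ω}
    {F : ℕ → EuclideanSpace ℝ (Fin d) → ℝ} {η β θ : ℕ → ℝ}
    {ε G M : ℝ} {L : NNReal} {R : Ω → ℕ → State d} {g : Ω → ℕ → EuclideanSpace ℝ (Fin d)}
    (h : ∀ ω, AdamPath F η β θ ε G M L (R ω) (g ω)) (hηpos : ∀ t, 0 < η t)
    (hη2 : Summable fun t => η t ^ 2) (hη : ¬ Summable η)
    (hp_int : ∀ t, Integrable (fun ω => ‖gradient (F t) (R ω t).x‖ ^ 2) P)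
    (hsum : Summable fun t =>
      ∫ ω, η (t + 1) * ‖gradient (F (t + 1)) (R ω (t + 1)).x‖ ^ 2 ∂P) :
    ∀ᵐ ω ∂P, Tendsto (fun t => ‖gradient (F t) (R ω t).x‖ ^ 2) atTop (𝓝 0) := by
  filter_upwards [ae_summable_of_summable_integral
    (fun t ω => mul_nonneg (hηpos (t + 1)).le (sq_nonneg _))
    (fun t => (hp_int (t + 1)).const_mul (η (t + 1))) hsum] with ω hω
  exact tendsto_zero_of_summable_mul (fun t => (hηpos t).le) (fun t => sq_nonneg _) hη2
    ((summable_nat_add_iff 1).1 hω) hη (h ω).abs_sq_norm_gradient_succ_sub_le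

/-! ### Dependence of the algorithm on the sampled indices -/

theorem run_congr {K : ℕ} (fk : Fin K → EuclideanSpace ℝ (Fin d) → ℝ)
    (S : ℕ → Matrix (Fin d) (Fin d) ℝ) (η β θ : ℕ → ℝ) (ε : ℝ) (x₀ : EuclideanSpace ℝ (Fin d))
    {k k' : ℕ → Fin K} (t : ℕ) (hk : ∀ s < t, k (s + 1) = k' (s + 1)) :
    run fk S η β θ ε x₀ k t = run fk S η β θ ε x₀ k' t := by
  induction t with
  | zero => rfl
  | succ t ih =>
    simp only [run]
    rw [ih fun s hs => hk s (hs.trans t.lt_succ_self), hk t t.lt_succ_self]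

theorem exists_run_eq {Ω : Type*} {K : ℕ} [Nonempty (Fin K)]
    (fk : Fin K → EuclideanSpace ℝ (Fin d) → ℝ)
    (S : ℕ → Matrix (Fin d) (Fin d) ℝ) (η β θ : ℕ → ℝ) (ε : ℝ) (x₀ : EuclideanSpace ℝ (Fin d))
    (k : ℕ → Ω → Fin K) (t : ℕ) : ∃ H : (Finset.range t → Fin K) → State d,
      ∀ ω, run fk S η β θ ε x₀ (fun s => k s ω) t = H fun i => k (i + 1) ω := by
  classical
  -- The entry `i` of `y` is the draw `i + 1`. All other indices get an arbitrary value, since the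
  -- first `t` steps never read them.
  refine ⟨fun y => run fk S η β θ ε x₀ (fun s => if h : s - 1 ∈ Finset.range t then y ⟨s - 1, h⟩
    else Classical.arbitrary _) t, fun ω => run_congr fk S η β θ ε x₀ t fun s hs => ?_⟩
  simp [hs]

/-- Any function of the state of the algorithm is integrable, as it takes finitely many values. -/
theorem integrable_comp_run {Ω : Type*} [MeasurableSpace Ω] {P : Measure Ω} [IsFiniteMeasure P]
    {K : ℕ} [Nonempty (Fin K)] (fk : Fin K → EuclideanSpace ℝ (Fin d) → ℝ)
    (S : ℕ → Matrix (Fin d) (Fin d) ℝ) (η β θ : ℕ → ℝ) (ε : ℝ) (x₀ : EuclideanSpace ℝ (Fin d))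
    {k : ℕ → Ω → Fin K} (hk : ∀ t, Measurable (k (t + 1))) (t : ℕ) (φ : State d → ℝ) :
    Integrable (fun ω => φ (run fk S η β θ ε x₀ (fun s => k s ω) t)) P := by
  obtain ⟨H, hH⟩ := exists_run_eq fk S η β θ ε x₀ k t
  simp only [hH]
  have hX : Measurable fun ω (i : Finset.range t) => k (i + 1) ω :=
    measurable_pi_lambda _ fun i => hk i
  exact (Integrable.of_finite (f := fun y => φ (H y))).comp_measurable hX

/-- Averaging a function of independent variables over the uniformly distributed one. -/
theorem integral_comp_indep_uniform {Ω α : Type*} [MeasurableSpace Ω] [MeasurableSpace α]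
    [Finite α] [MeasurableSingletonClass α] {P : Measure Ω} [IsProbabilityMeasure P] {K : ℕ}
    {X : Ω → α} {Y : Ω → Fin K} (hX : Measurable X) (hY : Measurable Y) (h : IndepFun X Y P)
    (hunif : ∀ j, P.real {ω | Y ω = j} = 1 / (K : ℝ)) (φ : α → Fin K → ℝ) :
    Integrable (fun ω => φ (X ω) (Y ω)) P ∧
      ∫ ω, φ (X ω) (Y ω) ∂P = ∫ ω, (1 / (K : ℝ)) * ∑ j, φ (X ω) j ∂P := by
  have hint : Integrable (fun ω => φ (X ω) (Y ω)) P :=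
    (Integrable.of_finite (f := fun y : α × Fin K => φ y.1 y.2)).comp_measurable (hX.prodMk hY)
  have hintj : ∀ j, Integrable (fun ω => φ (X ω) j) P := fun j =>
    (Integrable.of_finite (f := fun y => φ y j)).comp_measurable hX
  have hintj' : ∀ j, Integrable (fun ω => φ (X ω) j * if Y ω = j then 1 else 0) P := fun j =>
    (Integrable.of_finite (f := fun y : α × Fin K => φ y.1 j * if y.2 = j then 1 else 0)
      ).comp_measurable (hX.prodMk hY)
  refine ⟨hint, ?_⟩
  -- Splitting by the value of `Y` leaves products of a function of `X` and a function of `Y`, to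
  -- which independence applies.
  have e : ∀ ω, φ (X ω) (Y ω) = ∑ j, φ (X ω) j * if Y ω = j then 1 else 0 := by
    intro ω; simp
  have hj : ∀ j, ∫ ω, (if Y ω = j then (1 : ℝ) else 0) ∂P = 1 / (K : ℝ) := by
    intro j
    rw [← hunif j]
    refine Eq.trans ?_ (integral_indicator_one (μ := P) (hY (measurableSet_singleton j)))
    congr 1
    ext ω
    simp [Set.indicator]
  simp_rw [e]
  rw [integral_finsetSum _ fun j _ => hintj' j, integral_const_mul,
    integral_finsetSum _ fun j _ => hintj j, Finset.mul_sum]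
  refine Finset.sum_congr rfl fun j _ => ?_
  rw [h.integral_fun_comp_mul_comp (f := fun y => φ y j) (g := fun y => if y = j then (1 : ℝ) else 0)
    hX.aemeasurable hY.aemeasurable (Measurable.of_discrete).aestronglyMeasurable
    (Measurable.of_discrete).aestronglyMeasurable, hj, mul_comm]

/-- The state at time `t` depends only on draws `1, …, t`, so it is independent of draw `t + 1`.
This replaces conditional expectation. -/
theorem integral_comp_run {Ω : Type*} [MeasurableSpace Ω] {P : Measure Ω} [IsProbabilityMeasure P]
    {K : ℕ} [Nonempty (Fin K)] (fk : Fin K → EuclideanSpace ℝ (Fin d) → ℝ)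
    (S : ℕ → Matrix (Fin d) (Fin d) ℝ) (η β θ : ℕ → ℝ) (ε : ℝ) (x₀ : EuclideanSpace ℝ (Fin d))
    {k : ℕ → Ω → Fin K} (hk : ∀ t, Measurable (k (t + 1)))
    (hk_indep : iIndepFun (fun t : ℕ => k (t + 1)) P)
    (hk_unif : ∀ t j, P.real {ω | k (t + 1) ω = j} = 1 / (K : ℝ)) (t : ℕ)
    (φ : State d → Fin K → ℝ) :
    Integrable (fun ω => φ (run fk S η β θ ε x₀ (fun s => k s ω) t) (k (t + 1) ω)) P ∧
      ∫ ω, φ (run fk S η β θ ε x₀ (fun s => k s ω) t) (k (t + 1) ω) ∂P =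
        ∫ ω, (1 / (K : ℝ)) * ∑ j, φ (run fk S η β θ ε x₀ (fun s => k s ω) t) j ∂P := by
  obtain ⟨H, hH⟩ := exists_run_eq fk S η β θ ε x₀ k t
  simp only [hH]
  have hind : IndepFun (fun ω (i : Finset.range t) => k (i + 1) ω) (k (t + 1)) P :=
    IndepFun.comp (φ := fun y : Finset.range t → Fin K => y)
      (ψ := fun y : ({t} : Finset ℕ) → Fin K => y ⟨t, Finset.mem_singleton_self t⟩)
      (hk_indep.indepFun_finset (Finset.range t) {t} (by simp) hk) measurable_id
      (measurable_pi_apply _)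
  exact integral_comp_indep_uniform (X := fun ω (i : Finset.range t) => k (i + 1) ω)
    (measurable_pi_lambda _ fun i => hk i) (hk t) hind (hk_unif t) fun y j => φ (H y) j

/-! ### The AGS-Adam algorithm -/

theorem norm_gradient_le_of_moment {K : ℕ} {fk : Fin K → EuclideanSpace ℝ (Fin d) → ℝ} {lam : ℝ}
    (h : ∀ x, (1 / (K : ℝ)) * ∑ j, ‖gradient (fk j) x‖ ^ 2 ≤ lam) (j : Fin K)
    (x : EuclideanSpace ℝ (Fin d)) : ‖gradient (fk j) x‖ ≤ √(K * lam) := by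
  have hK : 0 < (K : ℝ) := Nat.cast_pos.2 (Fin.pos j)
  refine Real.le_sqrt_of_sq_le ?_
  have h1 := h x
  rw [one_div_mul_eq_div, div_le_iff₀ hK] at h1
  calc ‖gradient (fk j) x‖ ^ 2 ≤ ∑ j, ‖gradient (fk j) x‖ ^ 2 :=
        Finset.single_le_sum (f := fun j => ‖gradient (fk j) x‖ ^ 2)
          (fun i _ => sq_nonneg _) (Finset.mem_univ j)
    _ ≤ _ := by linarith

theorem norm_mean_le {K : ℕ} [Nonempty (Fin K)] {G : ℝ} {y : Fin K → EuclideanSpace ℝ (Fin d)}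
    (hy : ∀ j, ‖y j‖ ≤ G) : ‖(1 / (K : ℝ)) • ∑ j, y j‖ ≤ G := by
  have hK : 0 < (K : ℝ) := Nat.cast_pos.2 (Fin.pos (Classical.arbitrary (Fin K)))
  rw [norm_smul, Real.norm_of_nonneg (by positivity), one_div_mul_eq_div, div_le_iff₀ hK]
  refine (norm_sum_le_of_le _ fun j _ => hy j).trans_eq ?_
  simp [mul_comm]

/-- The mean over the samples of the sample alignment dominates the squared gradient norm. -/
theorem mul_sq_norm_gradient_le_mean {K : ℕ} {S : Matrix (Fin d) (Fin d) ℝ}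
    {fk : Fin K → EuclideanSpace ℝ (Fin d) → ℝ} {f : EuclideanSpace ℝ (Fin d) → ℝ} {G ε : ℝ}
    (hfk : ∀ j, Differentiable ℝ (fk j)) (hG : ∀ j x, ‖gradient (fk j) x‖ ≤ G)
    (h_mean : ∀ x, (1 / (K : ℝ)) * ∑ j, fk j x = f x) (hε : 0 < ε) {s : State d}
    (hs : s.Bounded G) :
    (√(G ^ 2 + ε))⁻¹ * ‖gradient (gaussSmooth S f) s.x‖ ^ 2 ≤
      (1 / (K : ℝ)) * ∑ j, inner ℝ (gradient (gaussSmooth S f) s.x)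
        (hadamard (invSqrt ε s.v) (gradient (gaussSmooth S (fk j)) s.x)) := by
  refine (mul_norm_sq_le_inner_hadamard (hs.le_invSqrt hε) _).trans_eq ?_
  rw [← inner_sum, ← hadamard_sum, ← inner_smul_right, ← hadamard_smul,
    ← gradient_gaussSmooth_mean hfk hG h_mean]

theorem not_summable_of_tendsto_sum_Icc {η : ℕ → ℝ}
    (h : Tendsto (fun T : ℕ => ∑ t ∈ Finset.Icc 1 T, η t) atTop atTop) :
    ¬ Summable fun t => η (t + 1) := by
  intro hs
  refine not_tendsto_nhds_of_tendsto_atTop h _ (hs.hasSum.tendsto_sum_nat.congr fun T => ?_)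
  rw [Finset.range_eq_Ico, Finset.sum_Ico_add' η 0 T 1]
  rfl

end AGSAdam

/-! ### Proof of the main theorem -/

theorem mainTheorem4
    {d K : ℕ}
    -- the sampled functions `fk 1, …, fk K` and the objective `f`
    (fk : Fin K → EuclideanSpace ℝ (Fin d) → ℝ) (f : EuclideanSpace ℝ (Fin d) → ℝ)
    (L : NNReal) (hf : AGSAdam.LSmooth L f) (hf_min : BddBelow (Set.range f))
    (hfk : ∀ j, Differentiable ℝ (fk j))
    (h_mean : ∀ x, (1 / (K : ℝ)) * ∑ j, fk j x = f x)
    (h_mean_grad : ∀ x, (1 / (K : ℝ)) • ∑ j, gradient (fk j) x = gradient f x)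
    (lam : ℝ) (h_moment : ∀ x, (1 / (K : ℝ)) * ∑ j, ‖gradient (fk j) x‖ ^ 2 ≤ lam)
    -- parameters of the algorithm, used for `t ≥ 1`
    (η β θ : ℕ → ℝ) (βbar ε : ℝ) (x₀ : EuclideanSpace ℝ (Fin d))
    (S : ℕ → Matrix (Fin d) (Fin d) ℝ)
    (hη : ∀ t, 1 ≤ t → 0 < η t) (hε : 0 < ε)
    (hβ : ∀ t, 1 ≤ t → 0 ≤ β t ∧ β t ≤ βbar) (hβbar : βbar < 1)
    (hθ : ∀ t, 1 ≤ t → 0 < θ t ∧ θ t < 1)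
    (hS : ∀ t, 1 ≤ t → (S t).PosDef)
    -- the sampled indices: independent and uniform on the `K` indices
    {Ω : Type*} [MeasurableSpace Ω] (P : Measure Ω) [IsProbabilityMeasure P]
    (k : ℕ → Ω → Fin K) (hk_meas : ∀ t, 1 ≤ t → Measurable (k t))
    (hk_indep : iIndepFun (fun t : ℕ => k (t + 1)) P)
    (hk_unif : ∀ t, 1 ≤ t → ∀ j, P.real {ω | k t ω = j} = 1 / (K : ℝ))
    -- step sizes
    (hη_sum : Tendsto (fun T : ℕ => ∑ t ∈ Finset.Icc 1 T, η t) atTop atTop)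
    (hη_sq : Summable (fun t : ℕ => η (t + 1) ^ 2))
    (hηθ : Summable (fun t : ℕ => η (t + 1) * (1 - θ (t + 1))))
    (hα : ∃ α : ℕ → ℝ, AntitoneOn α (Set.Ici 1) ∧
      ∃ C₀ C₁ : ℝ, 0 < C₀ ∧ 0 < C₁ ∧ ∀ t, 1 ≤ t → C₀ * α t ≤ η t ∧ η t ≤ C₁ * α t)
    -- bounds for a change of the smoothing matrix
    (B Btilde : Matrix (Fin d) (Fin d) ℝ → Matrix (Fin d) (Fin d) ℝ → ℝ)
    (hB : ∀ S₁ S₂ : Matrix (Fin d) (Fin d) ℝ, S₁.PosDef → S₂.PosDef → ∀ x,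
      |AGSAdam.gaussSmooth S₁ f x - AGSAdam.gaussSmooth S₂ f x| ≤ B S₁ S₂)
    (hBtilde : ∀ S₁ S₂ : Matrix (Fin d) (Fin d) ℝ, S₁.PosDef → S₂.PosDef → ∀ x,
      ‖gradient (AGSAdam.gaussSmooth S₁ f) x - gradient (AGSAdam.gaussSmooth S₂ f) x‖
        ≤ Btilde S₁ S₂)
    (Mtilde : ℝ) (hMtilde : 0 < Mtilde)
    (hBtilde_le : ∀ t, 1 ≤ t → Btilde (S (t + 1)) (S t) ≤ Mtilde * η t)
    (hB_sum : Summable (fun t : ℕ => B (S (t + 1)) (S t)))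
    (hS_lim : Tendsto (fun t => AGSAdam.matOpNorm (S t)) atTop (𝓝 0)) :
    (∀ᵐ ω ∂P, Tendsto
      (fun t => ‖gradient f (AGSAdam.run fk S η β θ ε x₀ (fun s => k s ω) t).x‖ ^ 2)
      atTop (𝓝 0)) ∧
    (∀ t, Integrable
      (fun ω => ‖gradient f (AGSAdam.run fk S η β θ ε x₀ (fun s => k s ω) t).x‖ ^ 2) P) ∧
    Tendsto
      (fun t => ∫ ω, ‖gradient f (AGSAdam.run fk S η β θ ε x₀ (fun s => k s ω) t).x‖ ^ 2 ∂P)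
      atTop (𝓝 0) := by
  obtain ⟨ω₀⟩ : Nonempty Ω := nonempty_of_isProbabilityMeasure P
  have : Nonempty (Fin K) := ⟨k 0 ω₀⟩
  set G : ℝ := √(K * lam)
  have hGk : ∀ j x, ‖gradient (fk j) x‖ ≤ G := AGSAdam.norm_gradient_le_of_moment h_moment
  have hGf : ∀ x, ‖gradient f x‖ ≤ G := fun x => by
    rw [← h_mean_grad x]; exact AGSAdam.norm_mean_le fun j => hGk j x
  obtain ⟨m, hm⟩ := hf_min
  have hm' : ∀ x, m ≤ f x := fun x => hm (Set.mem_range_self x)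
  obtain ⟨α, hα_anti, C₀, C₁, hC₀, hC₁, hα⟩ := hα
  -- Comparison with `α` makes `η` decreasing up to the factor `C₁ / C₀`, as the momentum weights
  -- require.
  have hmono : ∀ s t, s ≤ t → η (t + 1) ≤ C₁ / C₀ * η (s + 1) := by
    intro s t hst
    have h1 := hα (s + 1) (by omega)
    have h2 := hα (t + 1) (by omega)
    have h3 : α (t + 1) ≤ α (s + 1) :=
      hα_anti (Set.mem_Ici.2 (by omega)) (Set.mem_Ici.2 (by omega)) (by omega)
    calc η (t + 1) ≤ C₁ * α (s + 1) := h2.2.trans (by gcongr)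
      _ = C₁ / C₀ * (C₀ * α (s + 1)) := by field_simp
      _ ≤ _ := by have := h1.1; gcongr
  -- Update `t + 1` acts on the iterate at time `t`, so all parameters are shifted by one and `S 0`
  -- never occurs.
  let F : ℕ → EuclideanSpace ℝ (Fin d) → ℝ := fun t => AGSAdam.gaussSmooth (S (t + 1)) f
  let R : Ω → ℕ → AGSAdam.State d := fun ω t => AGSAdam.run fk S η β θ ε x₀ (fun s => k s ω) t
  let g : Ω → ℕ → EuclideanSpace ℝ (Fin d) := fun ω t =>
    gradient (AGSAdam.gaussSmooth (S (t + 1)) (fk (k (t + 1) ω))) (R ω t).x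
  have hpath : ∀ ω, AGSAdam.AdamPath F (fun t => η (t + 1)) (fun t => β (t + 1))
      (fun t => θ (t + 1)) ε G Mtilde L (R ω) (g ω) := fun ω =>
    { ε_pos := hε
      η_pos := fun t => hη _ (by omega)
      β_mem := fun t => ⟨(hβ (t + 1) (by omega)).1, ((hβ (t + 1) (by omega)).2.trans hβbar.le)⟩
      θ_mem := fun t => ⟨(hθ (t + 1) (by omega)).1.le, (hθ (t + 1) (by omega)).2.le⟩
      G_nonneg := Real.sqrt_nonneg _
      lsmooth := fun t => hf.gaussSmooth hGf _
      norm_gradient_le := fun t x => AGSAdam.norm_gradient_gaussSmooth_le hf.1 hGf _ x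
      norm_gradient_sub_le := fun t x =>
        (hBtilde _ _ (hS (t + 2) (by omega)) (hS (t + 1) (by omega)) x).trans
          (hBtilde_le (t + 1) (by omega))
      m_zero := rfl
      v_zero := rfl
      succ := fun t => rfl
      norm_sample_le := fun t => AGSAdam.norm_gradient_gaussSmooth_le (hfk _) (hGk _) _ _ }
  have hkm : ∀ t, Measurable (k (t + 1)) := fun t => hk_meas _ (by omega)
  have hint : ∀ t (φ : AGSAdam.State d → ℝ), Integrable (fun ω => φ (R ω t)) P := fun t φ =>
    AGSAdam.integrable_comp_run fk S η β θ ε x₀ hkm t φ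
  have hsample : ∀ t, Integrable (fun ω => AGSAdam.sampleAlignment F ε (R ω) (g ω) t) P ∧
      ∫ ω, AGSAdam.sampleAlignment F ε (R ω) (g ω) t ∂P =
        ∫ ω, (1 / (K : ℝ)) * ∑ j, inner ℝ (gradient (F t) (R ω t).x)
          (AGSAdam.hadamard (AGSAdam.invSqrt ε (R ω t).v)
            (gradient (AGSAdam.gaussSmooth (S (t + 1)) (fk j)) (R ω t).x)) ∂P := fun t =>
    AGSAdam.integral_comp_run fk S η β θ ε x₀ hkm hk_indep
      (fun t => hk_unif (t + 1) (by omega)) t fun s j => inner ℝ (gradient (F t) s.x)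
          (AGSAdam.hadamard (AGSAdam.invSqrt ε s.v)
            (gradient (AGSAdam.gaussSmooth (S (t + 1)) (fk j)) s.x))
  -- The alignment at `t` involves the state at `t + 1`, expressed here through the state at `t` and
  -- one fresh index.
  have halign : ∀ t, Integrable (fun ω => AGSAdam.alignment F ε (R ω) t) P := fun t =>
    (AGSAdam.integral_comp_run fk S η β θ ε x₀ hkm hk_indep
      (fun t => hk_unif (t + 1) (by omega)) t fun s j =>
        let s' := s.step (η (t + 1)) (β (t + 1)) (θ (t + 1)) ε
          (gradient (AGSAdam.gaussSmooth (S (t + 1)) (fk j)) s.x)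
        inner ℝ (gradient (F t) s.x) (AGSAdam.hadamard (AGSAdam.invSqrt ε s'.v) s'.m)).1
  have hp_int : ∀ t, Integrable (fun ω => ‖gradient (F t) (R ω t).x‖ ^ 2) P := fun t =>
    hint t fun s => ‖gradient (F t) s.x‖ ^ 2
  have hdescent : Summable fun t =>
      ∫ ω, η (t + 1 + 1) * ‖gradient (F (t + 1)) (R ω (t + 1)).x‖ ^ 2 ∂P := by
    have hBS : ∀ t x, |F (t + 1) x - F t x| ≤ B (S (t + 2)) (S (t + 1)) := fun t x =>
      hB _ _ (hS (t + 2) (by omega)) (hS (t + 1) (by omega)) x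
    -- The needed values of `B` are nonnegative by its bound at `x = 0`; shifting the series drops
    -- the term with `S 0`.
    refine AGSAdam.summable_integral_sq_norm_gradient hpath (c := (√(G ^ 2 + ε))⁻¹)
      (b := fun t => B (S (t + 2)) (S (t + 1))) (fun t => (hβ (t + 1) (by omega)).2) hβbar hmono
      hη_sq hηθ (fun t => (abs_nonneg _).trans (hBS t 0))
      ((summable_nat_add_iff (f := fun t => B (S (t + 1)) (S t)) 1).2 hB_sum)
      (fun t x => by linarith [(le_abs_self _).trans (hBS t x)])
      (fun t x => AGSAdam.le_gaussSmooth hf.1 hGf hm' _ x) hMtilde.le (by positivity)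
      (fun t => hint t fun s => F t s.x) halign (fun t => (hsample t).1) fun t => ?_
    rw [(hsample t).2, ← integral_const_mul]
    refine integral_mono ((hp_int t).const_mul _) (hint t fun s => (1 / (K : ℝ)) *
      ∑ j, inner ℝ (gradient (F t) s.x) (AGSAdam.hadamard (AGSAdam.invSqrt ε s.v)
        (gradient (AGSAdam.gaussSmooth (S (t + 1)) (fk j)) s.x))) fun ω => ?_
    exact AGSAdam.mul_sq_norm_gradient_le_mean hfk hGk h_mean hε ((hpath ω).bounded t)
  have hsmooth := AGSAdam.ae_tendsto_sq_norm_gradient hpath (fun t => hη (t + 1) (by omega)) hη_sq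
    (AGSAdam.not_summable_of_tendsto_sum_Icc hη_sum) hp_int hdescent
  have has : ∀ᵐ ω ∂P, Tendsto (fun t => ‖gradient f (R ω t).x‖ ^ 2) atTop (𝓝 0) := by
    filter_upwards [hsmooth] with ω hω
    have h1 : Tendsto (fun t => ‖gradient (F t) (R ω t).x‖) atTop (𝓝 0) := by
      simpa using hω.sqrt
    have h2 : Tendsto (fun t => L * (∫ u, ‖u‖ ∂AGSAdam.gaussMeasure d) *
        AGSAdam.matOpNorm (S (t + 1))) atTop (𝓝 0) := by
      simpa using ((tendsto_add_atTop_iff_nat 1).2 hS_lim).const_mul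
        (L * (∫ u, ‖u‖ ∂AGSAdam.gaussMeasure d))
    have h3 : Tendsto (fun t => ‖gradient f (R ω t).x‖) atTop (𝓝 0) := by
      refine squeeze_zero (fun t => norm_nonneg _) (fun t => ?_) (by simpa using h1.add h2)
      have h4 := AGSAdam.norm_gradient_gaussSmooth_sub_le hf hGf (S (t + 1)) (R ω t).x
      have h5 := norm_sub_norm_le (gradient f (R ω t).x) (gradient (F t) (R ω t).x)
      rw [norm_sub_rev] at h5
      linarith
    simpa using h3.pow 2
  have hf_int : ∀ t, Integrable (fun ω => ‖gradient f (R ω t).x‖ ^ 2) P := fun t =>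
    hint t fun s => ‖gradient f s.x‖ ^ 2
  refine ⟨has, hf_int, ?_⟩
  have hlim := tendsto_integral_of_dominated_convergence (fun _ => G ^ 2)
    (fun t => (hf_int t).1) (integrable_const _)
    (fun t => Eventually.of_forall fun ω => by
      rw [Real.norm_of_nonneg (sq_nonneg _)]
      have := hGf (R ω t).x
      gcongr) has
  simpa using hlim
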